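/- Tiles are unit squares centred at points of $\mathbb{Z}^2$, not rotatable, with at most one glue from an alphabet $\Pi$ on each side; each glue $g$ has a strength $str(g)\in\mathbb{Z}_{\ge 0}$. An assembly is a set of tiles at distinct points of $\mathbb{Z}^2$, and its shape is the set of tiled points. In the bond graph of an assembly, the edge between two adjacent tiles has weight $str(g)$ if both carry the same glue $g$ on their common side, and weight $0$ otherwise. For a positive integer $\tau$, an assembly is $\tau$-stable if every cut of its bond graph into two nonempty parts has weight at least $\tau$. An aTAM system $\Gamma=(T,\sigma,\tau)$ consists of a finite tile set $T$, a finite nonempty seed assembly $\sigma$ of tiles from $T$, and a positive integer $\tau$. An assembly $A$ grows in one step into $A\cup\{b\}$, where $b$ is a translate of a tile of $T$ placed at a point not tiled by $A$, if $A\cup\{b\}$ is $\tau$-stable. The producible assemblies are those obtained from $\sigma$ by finitely many such steps. The system $\Gamma$ strictly self-assembles a set $X\subseteq\mathbb{Z}^2$ if every producible assembly can grow, by a finite or infinite sequence of such steps, into an assembly whose shape is exactly $X$. Let $S_0=\{(0,0),(-1,0),(0,1),(-1,1)\}$, let $S_{i+1}=S_i\cup(S_i+2^i(1,2))\cup(S_i+2^i(-1,2))$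 for $i\ge 0$, and let $S_\infty=\bigcup_{i\ge 0}S_i$ (the non-tree discrete Sierpinski triangle). For a positive integer $c$, let $S^c_\infty$ be the scaling of $S_\infty$ by the factor $c$, in which each point $(x,y)$ is replaced by the $c\times c$ block $\{cx,\dots,cx+c-1\}\times\{cy,\dots,cy+c-1\}$. Theorem. For every positive integer $c$, no aTAM system strictly self-assembles $S^c_\infty$. -/

import Mathlib

/-- The four sides of a unit square tile. -/
inductive Side : Type
  | north
  | east
  | south
  | west
  deriving DecidableEq

/-- The unit vector pointing from the centre of a tile across the given side. -/
def Side.vec : Side → ℤ × ℤ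
  | .north => (0, 1)
  | .east => (1, 0)
  | .south => (0, -1)
  | .west => (-1, 0)

/-- The opposite side. -/
def Side.opp : Side → Side
  | .north => .south
  | .east => .west
  | .south => .north
  | .west => .east

/-- A unit square tile (up to translation): at most one glue on each side, and a label. -/
structure Tile (G : Type*) where
  glue : Side → Option G
  label : String

/-- An assembly: tiles at pairwise distinct points of `ℤ × ℤ`; `none` means that the point is
not tiled. -/
abbrev Assembly (G : Type*) := ℤ × ℤ → Option (Tile G)

/-- The shape of an assembly: the set of tiled points. -/
def Assembly.shape {G : Type*} (A : Assembly G) : Set (ℤ × ℤ) := {p | A p ≠ none}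

open Classical in
/-- The weight contributed by two overlapping (possibly absent) glues: equal glues contribute
their strength, unequal or absent ones contribute `0`. -/
noncomputable def glueWeight {G : Type*} (str : G → ℕ) : Option G → Option G → ℕ
  | some g, some h => if g = h then str g else 0
  | _, _ => 0

/-- The weight in the bond graph of `A` of the edge that joins the point `p` to its neighbour
across side `d` (`0` if one of the two points is not tiled). -/
noncomputable def Assembly.bond {G : Type*} (A : Assembly G) (str : G → ℕ) (p : ℤ × ℤ)
    (d : Side) : ℕ :=
  match A p, A (p + d.vec) with
  | some s, some t => glueWeight str (s.glue d) (t.glue d.opp)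
  | _, _ => 0

open Classical in
/-- The weight of the cut of the bond graph of `A` that separates the tiles in `U` from the
tiles outside `U`. Every edge of the cut is counted once, from its endpoint in `U`. The sum is
taken in `[0, ∞]`, so that it is meaningful for every assembly. -/
noncomputable def Assembly.cutWeight {G : Type*} (A : Assembly G) (str : G → ℕ)
    (U : Set (ℤ × ℤ)) : ENNReal :=
  ∑' e : (ℤ × ℤ) × Side,
    if e.1 ∈ U ∧ e.1 + e.2.vec ∉ U then ((A.bond str e.1 e.2 : ℕ) : ENNReal) else 0

/-- `A` is `τ`-stable: every cut of its bond graph into two nonempty parts has weight at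
least `τ`. -/
def Assembly.Stable {G : Type*} (A : Assembly G) (str : G → ℕ) (τ : ℕ) : Prop :=
  ∀ U : Set (ℤ × ℤ), U ⊆ A.shape → U.Nonempty → (A.shape \ U).Nonempty →
    (τ : ENNReal) ≤ A.cutWeight str U

/-- A tile system of the abstract Tile Assembly Model over the glue alphabet `G`: glue
strengths, a finite tile set, a finite nonempty seed assembly over the tile set and a positive
temperature. -/
structure ATAMSystem (G : Type*) where
  str : G → ℕ
  tiles : Set (Tile G)
  tiles_finite : tiles.Finite
  seed : Assembly G
  seed_over : ∀ p t, seed p = some t → t ∈ tiles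
  seed_finite : seed.shape.Finite
  seed_nonempty : seed.shape.Nonempty
  temp : ℕ
  temp_pos : 0 < temp

/-- `A` grows into `B` by a single tile attachment: `B` is `A` together with one tile from the
tile set at an untiled point, and `B` is stable at the temperature of the system. -/
def ATAMSystem.Step {G : Type*} (Γ : ATAMSystem G) (A B : Assembly G) : Prop :=
  ∃ p : ℤ × ℤ, ∃ t ∈ Γ.tiles, A p = none ∧ B = Function.update A p (some t) ∧
    B.Stable Γ.str Γ.temp

/-- The producible assemblies (all of them finite). -/
inductive ATAMSystem.Producible {G : Type*} (Γ : ATAMSystem G) : Assembly G → Prop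
  | base : ATAMSystem.Producible Γ Γ.seed
  | step {A B : Assembly G} :
      ATAMSystem.Producible Γ A → Γ.Step A B → ATAMSystem.Producible Γ B

/-- `A` can grow, by finitely or infinitely many single tile attachments, into an assembly of
shape `X`. Finite sequences of attachments are represented by sequences that are eventually
constant. -/
def ATAMSystem.GrowsToShape {G : Type*} (Γ : ATAMSystem G) (A : Assembly G)
    (X : Set (ℤ × ℤ)) : Prop :=
  ∃ α : ℕ → Assembly G, α 0 = A ∧ (∀ n, α (n + 1) = α n ∨ Γ.Step (α n) (α (n + 1))) ∧
    ⋃ n, (α n).shape = X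

/-- `Γ` strictly self-assembles the (possibly infinite) shape `X`: every producible assembly
can grow into an assembly that places tiles exactly on the points of `X`. -/
def ATAMSystem.StrictlySelfAssembles {G : Type*} (Γ : ATAMSystem G) (X : Set (ℤ × ℤ)) : Prop :=
  ∀ A : Assembly G, Γ.Producible A → Γ.GrowsToShape A X

/-- The stages `S_i` of the non-tree discrete Sierpinski triangle. -/
def sierpinskiStage : ℕ → Set (ℤ × ℤ)
  | 0 => {(0, 0), (-1, 0), (0, 1), (-1, 1)}
  | i + 1 => sierpinskiStage i ∪
      {q | ∃ p ∈ sierpinskiStage i, ∃ v ∈ ({(1, 2), (-1, 2)} : Set (ℤ × ℤ)),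
        q = p + (2 ^ i : ℤ) • v}

/-- The non-tree discrete Sierpinski triangle `S_∞`. -/
def sierpinskiTriangle : Set (ℤ × ℤ) := ⋃ i, sierpinskiStage i

/-- The scaling of `X` by the factor `c`: every point is replaced by a `c × c` block of
points. -/
def scaleShape (c : ℕ) (X : Set (ℤ × ℤ)) : Set (ℤ × ℤ) :=
  {p | ∃ q ∈ X, (c * q.1 ≤ p.1 ∧ p.1 < c * q.1 + c) ∧ (c * q.2 ≤ p.2 ∧ p.2 < c * q.2 + c)}

/-! The proof is a window-movie argument. Above the stage `S_j`, each half of the scaled triangle is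
joined to the rest only at one corner, through `2c` points, and along the centre line. Follow one
growth sequence. When it first touches the centre line above `S_j`, it has done so from one side
only, since tiles come singly (`exists_first_touch`). Up to that time, all bonds into the half on
that side pass through the corner window (`crossesAtWindow_cornerWindow`).

A window shows finitely many contents, so infinitely many `j` compete for finitely many pairs of a
side and a set of window contents seen up to the touching time. Two levels `i < i'` share the same
pair. Growth is monotone, so these contents form a chain under extension and their set already
determines their order. The growth behind the window at level `i'` can therefore be replayed,
translated, behind the window at level `i` (`splice_producible`).

The part behind the window at level `i'` extends to its own centre line, so its translate at level
`i` must cross the centre line there. Just before the first crossing the spliced assembly is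
producible, hence lies in the triangle. In row `2 ^ (m + 1) - 1` of Pascal's triangle mod 2, the
crossing then needs two adjacent central entries to survive an upward move by `2 ^ i' - 2 ^ i` rows;
a binary digit excludes this (`Submask.not_both`, `false_of_crossing`). -/

theorem Side.opp_opp (d : Side) : d.opp.opp = d := by cases d <;> rfl

theorem Side.vec_opp (d : Side) : d.opp.vec = -d.vec := by cases d <;> rfl

theorem Side.vec_ne_zero (d : Side) : d.vec ≠ 0 := by cases d <;> decide

theorem Side.vec_injective : Function.Injective Side.vec := by
  intro a b h
  cases a <;> cases b <;> first | rfl | (revert h; decide)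

theorem glueWeight_comm {G : Type*} (str : G → ℕ) (a b : Option G) :
    glueWeight str a b = glueWeight str b a := by
  cases a <;> cases b <;> simp only [glueWeight]
  split_ifs with h1 h2 h2 <;> simp_all

/-! ### Bonds, cuts and stability -/

namespace Assembly

variable {G : Type*}

theorem bond_symm (A : Assembly G) (str : G → ℕ) (p : ℤ × ℤ) (d : Side) :
    A.bond str (p + d.vec) d.opp = A.bond str p d := by
  have h : p + d.vec + d.opp.vec = p := by rw [Side.vec_opp]; abel
  unfold bond
  rw [h, Side.opp_opp]
  cases A p <;> cases A (p + d.vec) <;> simp [glueWeight_comm]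

theorem bond_eq_zero_left {A : Assembly G} (str : G → ℕ) {p : ℤ × ℤ} (d : Side)
    (h : A p = none) : A.bond str p d = 0 := by
  simp [bond, h]

theorem bond_eq_zero_right {A : Assembly G} (str : G → ℕ) {p : ℤ × ℤ} (d : Side)
    (h : A (p + d.vec) = none) : A.bond str p d = 0 := by
  unfold bond
  rw [h]
  cases A p <;> rfl

theorem bond_congr {A B : Assembly G} (str : G → ℕ) {p q : ℤ × ℤ} (d : Side)
    (h : A p = B q) (h' : A (p + d.vec) = B (q + d.vec)) : A.bond str p d = B.bond str q d := by
  simp [bond, h, h']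

theorem bond_le_bond_update {A : Assembly G} (str : G → ℕ) {p : ℤ × ℤ} (hp : A p = none)
    (t : Tile G) (q : ℤ × ℤ) (d : Side) :
    A.bond str q d ≤ Assembly.bond (Function.update A p (some t)) str q d := by
  by_cases h1 : q = p
  · subst h1; rw [bond_eq_zero_left str d hp]; exact Nat.zero_le _
  by_cases h2 : q + d.vec = p
  · rw [bond_eq_zero_right str d (by rw [h2, hp])]; exact Nat.zero_le _
  · refine (bond_congr str d ?_ ?_).le
    · rw [Function.update_of_ne h1]
    · rw [Function.update_of_ne h2]

open Classical in
theorem cutWeight_singleton (A : Assembly G) (str : G → ℕ) (p : ℤ × ℤ) :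
    A.cutWeight str {p} = ∑' d : Side, ((A.bond str p d : ℕ) : ENNReal) := by
  have hinj : Function.Injective (fun d : Side => ((p, d) : (ℤ × ℤ) × Side)) :=
    fun a b h => (Prod.mk.inj h).2
  unfold cutWeight
  rw [← hinj.tsum_eq]
  · refine tsum_congr fun d => ?_
    have : p + d.vec ≠ p := by simpa using d.vec_ne_zero
    simp [this]
  · rintro ⟨q, d⟩ h
    have : q = p := by
      by_contra hq
      simp [hq] at h
    exact ⟨d, by rw [this]⟩

-- Every cut of the enlarged assembly either restricts to a cut of `C`, whose weight can only have
-- grown, or isolates the new tile. Stability after an attachment is thus a condition at the new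
-- point alone, which makes attachments transferable between assemblies.
open Classical in
theorem Stable.update {C : Assembly G} {str : G → ℕ} {τ : ℕ} (hC : C.Stable str τ)
    {p : ℤ × ℤ} (hp : C p = none) {t : Tile G}
    (ht : (τ : ENNReal) ≤
      ∑' d : Side, ((Assembly.bond (Function.update C p (some t)) str p d : ℕ) : ENNReal)) :
    Assembly.Stable (Function.update C p (some t)) str τ := by
  intro U hU hne hne'
  have hmem : ∀ q, q ≠ p → q ∈ Assembly.shape (Function.update C p (some t)) → q ∈ C.shape := by
    intro q hq h
    simpa [shape, Function.update_of_ne hq] using h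
  have hmem' : ∀ q, q ∈ C.shape → q ∈ Assembly.shape (Function.update C p (some t)) := by
    intro q h
    by_cases hq : q = p
    · subst hq; simp [shape]
    · simpa [shape, Function.update_of_ne hq] using h
  have hpC : p ∉ C.shape := by simp [shape, hp]
  by_cases hpU : p ∈ U
  · by_cases hs : (U \ {p}).Nonempty
    · refine (hC (U \ {p}) (fun q hq => hmem q hq.2 (hU hq.1)) hs ?_).trans ?_
      · obtain ⟨q, hq, hqU⟩ := hne'
        have hqp : q ≠ p := fun h => hqU (h ▸ hpU)
        exact ⟨q, hmem q hqp hq, fun h => hqU h.1⟩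
      · refine ENNReal.tsum_le_tsum ?_
        rintro ⟨q, d⟩
        dsimp only
        split_ifs with h1 h2 h2
        · exact_mod_cast bond_le_bond_update str hp t q d
        · have : q + d.vec = p := by
            by_contra h3
            exact h2 ⟨h1.1.1, fun h4 => h1.2 ⟨h4, h3⟩⟩
          rw [bond_eq_zero_right str d (by rw [this, hp])]
          simp
        · exact zero_le
        · exact le_rfl
    · have : U = {p} := by
        ext q
        constructor
        · intro hq
          by_contra h
          exact hs ⟨q, hq, h⟩
        · rintro rfl
          exact hpU
      rw [this, cutWeight_singleton]
      exact ht
  · have hUC : U ⊆ C.shape := fun q hq => hmem q (fun h => hpU (h ▸ hq)) (hU hq)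
    by_cases hs : (C.shape \ U).Nonempty
    · refine (hC U hUC hne hs).trans (ENNReal.tsum_le_tsum ?_)
      rintro ⟨q, d⟩
      dsimp only
      split_ifs with h1
      · exact_mod_cast bond_le_bond_update str hp t q d
      · exact le_rfl
    -- Here `U` is all of `C`, so the edges at `p` are counted from their far endpoints.
    · refine ht.trans ?_
      have hinj : Function.Injective
          (fun d : Side => ((p + d.vec, d.opp) : (ℤ × ℤ) × Side)) := fun a b h =>
        Side.vec_injective (add_left_cancel (Prod.mk.inj h).1)
      unfold cutWeight
      refine le_trans (ENNReal.tsum_le_tsum fun d => ?_)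
        (ENNReal.tsum_comp_le_tsum_of_injective hinj _)
      dsimp only
      have h : p + d.vec + d.opp.vec = p := by rw [Side.vec_opp]; abel
      rw [h, bond_symm]
      by_cases hd : p + d.vec ∈ U
      · simp [hd, hpU]
      · have hz : C (p + d.vec) = none := by
          by_contra hcon
          exact hs ⟨_, hcon, hd⟩
        rw [bond_eq_zero_right str d]
        · simp
        · rw [Function.update_of_ne (by simpa using d.vec_ne_zero), hz]

end Assembly

/-! ### Attachments and growth sequences -/

namespace ATAMSystem

variable {G : Type*} {Γ : ATAMSystem G}

/-- A tile that attaches to a nonempty assembly binds with total strength at least `τ`. -/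
theorem temp_le_tsum_bond {A : Assembly G} {p : ℤ × ℤ} {t : Tile G} (hA : A.shape.Nonempty)
    (hp : A p = none) (hs : Assembly.Stable (Function.update A p (some t)) Γ.str Γ.temp) :
    (Γ.temp : ENNReal) ≤
      ∑' d : Side, ((Assembly.bond (Function.update A p (some t)) Γ.str p d : ℕ) : ENNReal) := by
  rw [← Assembly.cutWeight_singleton]
  refine hs {p} ?_ ⟨p, rfl⟩ ?_
  · rintro q rfl
    simp [Assembly.shape]
  · obtain ⟨q, hq⟩ := hA
    have hqp : q ≠ p := by
      rintro rfl
      exact hq hp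
    exact ⟨q, by simpa [Assembly.shape, Function.update_of_ne hqp] using hq, hqp⟩

theorem exists_neighbour_of_stable_update {A : Assembly G} {p : ℤ × ℤ} {t : Tile G}
    (hA : A.shape.Nonempty) (hp : A p = none)
    (hs : Assembly.Stable (Function.update A p (some t)) Γ.str Γ.temp) :
    ∃ d : Side, A (p + d.vec) ≠ none := by
  by_contra hcon
  push Not at hcon
  have h := temp_le_tsum_bond hA hp hs
  have h0 : ∀ d : Side, Assembly.bond (Function.update A p (some t)) Γ.str p d = 0 := fun d =>
    Assembly.bond_eq_zero_right _ d (by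
      rw [Function.update_of_ne (by simpa using d.vec_ne_zero), hcon d])
  simp only [h0, Nat.cast_zero, tsum_zero, nonpos_iff_eq_zero, Nat.cast_eq_zero] at h
  exact Γ.temp_pos.ne' h

/-- A tile that attaches to `A` at `p` also attaches, at the translated point `p + v`, to every
stable assembly that contains the translates of the neighbours of `p` in `A`. -/
theorem step_update_of_neighbours {A C : Assembly G} {p v : ℤ × ℤ} {t : Tile G}
    (hA : A.shape.Nonempty) (ht : t ∈ Γ.tiles) (hp : A p = none)
    (hs : Assembly.Stable (Function.update A p (some t)) Γ.str Γ.temp)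
    (hC : C.Stable Γ.str Γ.temp) (hCp : C (p + v) = none)
    (hn : ∀ d : Side, A (p + d.vec) ≠ none → C (p + v + d.vec) = A (p + d.vec)) :
    Γ.Step C (Function.update C (p + v) (some t)) := by
  refine ⟨p + v, t, ht, hCp, rfl, hC.update hCp
    ((temp_le_tsum_bond hA hp hs).trans (ENNReal.tsum_le_tsum fun d => ?_))⟩
  have e1 : p + d.vec ≠ p := by simpa using d.vec_ne_zero
  have e2 : p + v + d.vec ≠ p + v := by simpa using d.vec_ne_zero
  by_cases h : A (p + d.vec) = none
  · rw [Assembly.bond_eq_zero_right _ d (by rw [Function.update_of_ne e1, h])]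
    simp
  · rw [Assembly.bond_congr (B := Function.update C (p + v) (some t)) (q := p + v) Γ.str d]
    · simp
    · rw [Function.update_of_ne e1, Function.update_of_ne e2, hn d h]

/-- A sequence of single tile attachments, possibly with pauses. -/
def IsGrowth (Γ : ATAMSystem G) (α : ℕ → Assembly G) : Prop :=
  ∀ n, α (n + 1) = α n ∨ Γ.Step (α n) (α (n + 1))

theorem IsGrowth.eq_of_le {α : ℕ → Assembly G} (h : Γ.IsGrowth α) {m n : ℕ} (hmn : m ≤ n)
    {p : ℤ × ℤ} (hp : α m p ≠ none) : α n p = α m p := by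
  induction n, hmn using Nat.le_induction with
  | base => rfl
  | succ n _ ih =>
    rcases h n with h | ⟨q, t, _, hq, h, _⟩
    · rw [h, ih]
    · have : p ≠ q := by
        rintro rfl
        exact hp (ih ▸ hq)
      rw [h, Function.update_of_ne this, ih]

theorem IsGrowth.ne_none_of_le {α : ℕ → Assembly G} (h : Γ.IsGrowth α) {m n : ℕ} (hmn : m ≤ n)
    {p : ℤ × ℤ} (hp : α m p ≠ none) : α n p ≠ none := by
  rwa [h.eq_of_le hmn hp]

theorem IsGrowth.producible {α : ℕ → Assembly G} (h : Γ.IsGrowth α) (h0 : Γ.Producible (α 0))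
    (n : ℕ) : Γ.Producible (α n) := by
  induction n with
  | zero => exact h0
  | succ n ih =>
    rcases h n with h | h
    · rwa [h]
    · exact ih.step h

theorem Producible.finite_shape {A : Assembly G} (h : Γ.Producible A) : A.shape.Finite := by
  induction h with
  | base => exact Γ.seed_finite
  | step _ hs ih =>
    obtain ⟨p, t, _, _, rfl, _⟩ := hs
    refine (ih.insert p).subset fun q hq => ?_
    by_cases hqp : q = p
    · exact Or.inl hqp
    · right
      simpa [Assembly.shape, Function.update_of_ne hqp] using hq

theorem Producible.mem_tiles {A : Assembly G} (h : Γ.Producible A) :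
    ∀ p t, A p = some t → t ∈ Γ.tiles := by
  induction h with
  | base => exact Γ.seed_over
  | step _ hs ih =>
    obtain ⟨p, s, hs, _, rfl, _⟩ := hs
    intro q t hq
    by_cases hqp : q = p
    · subst hqp
      simp only [Function.update_self, Option.some.injEq] at hq
      exact hq ▸ hs
    · rw [Function.update_of_ne hqp] at hq
      exact ih q t hq

theorem Producible.stable {A : Assembly G} (h : Γ.Producible A) (hA : A ≠ Γ.seed) :
    A.Stable Γ.str Γ.temp := by
  cases h with
  | base => exact absurd rfl hA
  | step _ hs =>
    obtain ⟨_, _, _, _, _, hs⟩ := hs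
    exact hs

theorem StrictlySelfAssembles.shape_subset {X : Set (ℤ × ℤ)} (h : Γ.StrictlySelfAssembles X)
    {A : Assembly G} (hA : Γ.Producible A) : A.shape ⊆ X := by
  obtain ⟨α, h0, _, hX⟩ := h A hA
  rw [← hX, ← h0]
  exact Set.subset_iUnion (fun n => (α n).shape) 0

/-- If the contents of the window `w'` all occur as contents of the window `w`, and both windows
have the same content after the next attachment, which changes the content of `w'`, then the
present content of `w` extends that of `w'`. -/
theorem IsGrowth.window_pred_eq {β : ℕ → Assembly G} (hβ : Γ.IsGrowth β) {ι : Type*}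
    {w w' : ι → ℤ × ℤ} {T T' : ℕ}
    (hV : ∀ b ≤ T', ∃ a ≤ T, ∀ u, β a (w u) = β b (w' u)) {a b : ℕ} (hb : b + 1 ≤ T')
    (hab : ∀ u, β (a + 1) (w u) = β (b + 1) (w' u))
    (hne : ∃ u, β (b + 1) (w' u) ≠ β b (w' u)) :
    ∀ u, β b (w' u) ≠ none → β a (w u) = β b (w' u) := by
  -- If `a'` exceeded `a`, the content of `w` at `a'` would extend that at `a + 1`, and so would
  -- already include the tile that `w'` gains only at `b + 1`.
  obtain ⟨a', -, ha'⟩ := hV b (by omega)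
  have hlt : a' ≤ a := by
    by_contra hcon
    obtain ⟨u, hu⟩ := hne
    refine hu ?_
    by_cases hz : β (a + 1) (w u) = none
    · have hz' : β (b + 1) (w' u) = none := by rw [← hab, hz]
      rw [hz']
      by_contra hc
      exact hβ.ne_none_of_le (Nat.le_succ b) (Ne.symm hc) hz'
    · rw [← hab, ← ha', hβ.eq_of_le (show a + 1 ≤ a' by omega) hz]
  intro u hu
  rw [← ha'] at hu ⊢
  exact hβ.eq_of_le hlt hu

/-! ### Splicing two stages of a growth sequence along a window -/

open Classical in
/-- The assembly `β b`, translated by `v`, inside `I`, and the assembly `β a` outside `I`. -/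
noncomputable def splice (β : ℕ → Assembly G) (I : Set (ℤ × ℤ)) (v : ℤ × ℤ) (a b : ℕ) :
    Assembly G :=
  fun p => if p ∈ I then β b (p - v) else β a p

/-- Every bond of `A` that leaves the region `I` joins two points of the window `w`. -/
def CrossesAtWindow {ι : Type*} (A : Assembly G) (I : Set (ℤ × ℤ)) (w : ι → ℤ × ℤ) : Prop :=
  ∀ (p : ℤ × ℤ) (d : Side), p ∈ I → p + d.vec ∉ I → A p ≠ none → A (p + d.vec) ≠ none →
    p ∈ Set.range w ∧ p + d.vec ∈ Set.range w

section Splice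

variable {β : ℕ → Assembly G} {ι : Type*} {w w' : ι → ℤ × ℤ} {I I' : Set (ℤ × ℤ)} {v : ℤ × ℤ}
  {T T' : ℕ}

/-- A tile placed outside `I` sees its outer neighbours unchanged. Any tiled neighbour inside `I` is
a window point, where `hab` makes the translated stage `b` agree with stage `a`. -/
theorem IsGrowth.splice_succ_outer (hβ : Γ.IsGrowth β) (hne : ∀ n, (β n).shape.Nonempty)
    (hwv : ∀ u, w u = w' u + v) (hT : CrossesAtWindow (β T) I w) {a b : ℕ} (ha : a + 1 ≤ T)
    (hab : ∀ u, β a (w u) = β b (w' u))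
    (hC : Γ.Producible (splice β I v a b) ∧ (splice β I v a b).Stable Γ.str Γ.temp) :
    Γ.Producible (splice β I v (a + 1) b) ∧
      (splice β I v (a + 1) b).Stable Γ.str Γ.temp := by
  rcases hβ a with h | ⟨p, t, ht, hp, h, hs⟩
  · have : splice β I v (a + 1) b = splice β I v a b := by
      funext q; simp only [splice, h]
    rwa [this]
  by_cases hpI : p ∈ I
  · have : splice β I v (a + 1) b = splice β I v a b := by
      funext q
      unfold splice
      split_ifs with hq
      · rfl
      · rw [h, Function.update_of_ne (by rintro rfl; exact hq hpI)]
    rwa [this]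
  have heq : splice β I v (a + 1) b = Function.update (splice β I v a b) (p + 0) (some t) := by
    funext q
    by_cases hq : q = p
    · subst hq
      rw [add_zero, Function.update_self]
      simp [splice, hpI, h]
    · rw [add_zero, Function.update_of_ne hq]
      simp only [splice, h, Function.update_of_ne hq]
  have hstep : Γ.Step (splice β I v a b) (splice β I v (a + 1) b) := by
    rw [heq]
    refine step_update_of_neighbours (hne a) ht hp (h ▸ hs) hC.2 (by simp [splice, hpI, hp]) ?_
    intro d hd
    rw [add_zero]
    by_cases hdI : p + d.vec ∈ I
    · have e : p + d.vec + d.opp.vec = p := by rw [Side.vec_opp]; abel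
      obtain ⟨⟨u, hu⟩, -⟩ := hT (p + d.vec) d.opp hdI (by rwa [e])
        (hβ.ne_none_of_le (by omega) hd)
        (by rw [e]; exact hβ.ne_none_of_le ha (by simp [h]))
      simp only [splice, hdI, if_true]
      rw [← hu, hab, hwv, add_sub_cancel_right]
    · simp [splice, hdI]
  exact ⟨hC.1.step hstep, by obtain ⟨_, _, _, _, _, h⟩ := hstep; exact h⟩

/-- The mirror case of `splice_succ_outer`. The translate of `I'` may be larger than `I`, so `hin`
is needed to keep the tiles already placed, and the new one, inside `I`. -/
theorem IsGrowth.splice_succ_inner (hβ : Γ.IsGrowth β) (hne : ∀ n, (β n).shape.Nonempty)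
    (hwv : ∀ u, w u = w' u + v) (hI : ∀ p ∈ I, p - v ∈ I')
    (hT : CrossesAtWindow (β T') I' w') {a b : ℕ} (hb : b + 1 ≤ T')
    (hab : ∀ u, β a (w u) = β b (w' u))
    (hin : ∀ p ∈ I', β (b + 1) p ≠ none → p + v ∈ I)
    (hC : Γ.Producible (splice β I v a b) ∧ (splice β I v a b).Stable Γ.str Γ.temp) :
    Γ.Producible (splice β I v a (b + 1)) ∧
      (splice β I v a (b + 1)).Stable Γ.str Γ.temp := by
  rcases hβ b with h | ⟨p, t, ht, hp, h, hs⟩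
  · have : splice β I v a (b + 1) = splice β I v a b := by
      funext q; simp only [splice, h]
    rwa [this]
  by_cases hpI : p ∈ I'
  swap
  · have : splice β I v a (b + 1) = splice β I v a b := by
      funext q
      unfold splice
      split_ifs with hq
      · rw [h, Function.update_of_ne (by rintro rfl; exact hpI (hI q hq))]
      · rfl
    rwa [this]
  have hpv : p + v ∈ I := hin p hpI (by simp [h])
  have heq : splice β I v a (b + 1) = Function.update (splice β I v a b) (p + v) (some t) := by
    funext q
    by_cases hq : q = p + v
    · subst hq
      rw [Function.update_self]
      simp [splice, hpv, h]
    · rw [Function.update_of_ne hq]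
      have : q - v ≠ p := fun e => hq (by rw [← e]; abel)
      simp only [splice, h, Function.update_of_ne this]
  have hstep : Γ.Step (splice β I v a b) (splice β I v a (b + 1)) := by
    rw [heq]
    refine step_update_of_neighbours (hne b) ht hp (h ▸ hs) hC.2 (by simp [splice, hpv, hp]) ?_
    intro d hd
    have e : p + v + d.vec = p + d.vec + v := by abel
    by_cases hdI : p + v + d.vec ∈ I
    · simp only [splice, hdI, if_true]
      rw [e, add_sub_cancel_right]
    · have hd' : β (b + 1) (p + d.vec) ≠ none := hβ.ne_none_of_le (Nat.le_succ b) hd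
      have hdI' : p + d.vec ∉ I' := fun hc => hdI (e ▸ hin _ hc hd')
      obtain ⟨-, ⟨u, hu⟩⟩ := hT p d hpI hdI' (hβ.ne_none_of_le hb (by simp [h]))
        (hβ.ne_none_of_le hb hd')
      simp only [splice, hdI, if_false]
      rw [e, ← hu, ← hwv, hab]
  exact ⟨hC.1.step hstep, by obtain ⟨_, _, _, _, _, h⟩ := hstep; exact h⟩

/-- Two stages of a growth sequence with equal window contents can be spliced along the window,
provided that the sets of contents that the two windows run through are the same. -/
theorem IsGrowth.splice_producible (hβ : Γ.IsGrowth β) (hne : ∀ n, (β n).shape.Nonempty)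
    (h0 : Γ.Producible (β 0)) (h0s : (β 0).Stable Γ.str Γ.temp)
    (hwv : ∀ u, w u = w' u + v) (hI : ∀ p ∈ I, p - v ∈ I')
    (hw0 : ∀ u, β 0 (w u) = none) (hw0' : ∀ u, β 0 (w' u) = none)
    (hI0 : ∀ p ∈ I, β 0 p = none) (hI0' : ∀ p ∈ I', β 0 p = none)
    (hT : CrossesAtWindow (β T) I w) (hT' : CrossesAtWindow (β T') I' w')
    (hV : ∀ b ≤ T', ∃ a ≤ T, ∀ u, β a (w u) = β b (w' u))
    (hV' : ∀ a ≤ T, ∃ b ≤ T', ∀ u, β b (w' u) = β a (w u)) (N : ℕ) :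
    ∀ a b : ℕ, a + b = N → a ≤ T → b ≤ T' → (∀ u, β a (w u) = β b (w' u)) →
      (∀ p ∈ I', β b p ≠ none → p + v ∈ I) →
      Γ.Producible (splice β I v a b) ∧ (splice β I v a b).Stable Γ.str Γ.temp := by
  induction N using Nat.strong_induction_on with
  | _ N ih =>
  intro a b hN ha hb hab hin
  have hin_mono : ∀ b' ≤ b, ∀ p ∈ I', β b' p ≠ none → p + v ∈ I := fun b' hb' p hp hpn =>
    hin p hp (hβ.ne_none_of_le hb' hpn)
  by_cases hz : a = 0 ∧ b = 0
  · obtain ⟨rfl, rfl⟩ := hz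
    have : splice β I v 0 0 = β 0 := by
      funext q
      unfold splice
      split_ifs with hq
      · rw [hI0 q hq, hI0' _ (hI q hq)]
      · rfl
    rw [this]
    exact ⟨h0, h0s⟩
  -- If one of the two stages can be lowered without destroying the equality of the windows, a
  -- single attachment is undone. Otherwise both last attachments change their windows.
  by_cases hA : ∃ a', a = a' + 1 ∧ ∀ u, β a' (w u) = β b (w' u)
  · obtain ⟨a', rfl, ha'⟩ := hA
    exact hβ.splice_succ_outer hne hwv hT ha ha'
      (ih _ (by omega) a' b rfl (by omega) hb ha' hin)
  by_cases hB : ∃ b', b = b' + 1 ∧ ∀ u, β a (w u) = β b' (w' u)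
  · obtain ⟨b', rfl, hb'⟩ := hB
    exact hβ.splice_succ_inner hne hwv hI hT' hb hb' hin
      (ih _ (by omega) a b' rfl ha (by omega) hb' (hin_mono _ (by omega)))
  have ha0 : a ≠ 0 := by
    rintro rfl
    refine hB ⟨b - 1, by omega, fun u => ?_⟩
    rw [hw0]
    by_contra hc
    exact hβ.ne_none_of_le (show b - 1 ≤ b by omega) (Ne.symm hc) (by rw [← hab, hw0])
  have hb0 : b ≠ 0 := by
    rintro rfl
    refine hA ⟨a - 1, by omega, fun u => ?_⟩
    rw [hw0']
    by_contra hc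
    exact hβ.ne_none_of_le (show a - 1 ≤ a by omega) hc (by rw [hab, hw0'])
  obtain ⟨a, rfl⟩ := Nat.exists_eq_succ_of_ne_zero ha0
  obtain ⟨b, rfl⟩ := Nat.exists_eq_succ_of_ne_zero hb0
  simp only [Nat.succ_eq_add_one] at *
  have hA' : ∃ u, β (a + 1) (w u) ≠ β a (w u) := by
    by_contra hc
    push Not at hc
    exact hA ⟨a, rfl, fun u => by rw [← hc, hab]⟩
  have hB' : ∃ u, β (b + 1) (w' u) ≠ β b (w' u) := by
    by_contra hc
    push Not at hc
    exact hB ⟨b, rfl, fun u => by rw [hab, hc]⟩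
  -- The two windows run through the same chain of contents, so equal contents that are both newly
  -- reached have equal predecessors.
  have hpred : ∀ u, β a (w u) = β b (w' u) := by
    have h1 := hβ.window_pred_eq hV hb hab hB'
    have h2 := hβ.window_pred_eq hV' ha (fun u => (hab u).symm) hA'
    intro u
    by_cases hu : β b (w' u) = none
    · by_contra hc
      exact hc (h2 u (fun h => hc (h.trans hu.symm))).symm
    · exact h1 u hu
  have hprev := ih _ (by omega) a b rfl (by omega) (by omega) hpred (hin_mono _ (by omega))
  obtain ⟨u, hu⟩ := hA'
  have hu' : β (b + 1) (w' u) ≠ β b (w' u) := by rwa [← hab, ← hpred]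
  -- Both attachments place the same tile at corresponding window points. The splice receives it
  -- once, from the stage that governs the side of the cut on which it lies.
  by_cases huI : w u ∈ I
  · have : splice β I v (a + 1) (b + 1) = splice β I v a (b + 1) := by
      funext q
      unfold splice
      split_ifs with hq
      · rfl
      · rcases hβ a with h | ⟨p, t, _, _, h, _⟩
        · rw [h]
        · rw [h, Function.update_of_ne]
          rintro rfl
          have : w u = q := by
            by_contra hne
            exact hu (by rw [h, Function.update_of_ne hne])
          exact hq (this ▸ huI)
    rw [this]
    exact hβ.splice_succ_inner hne hwv hI hT' hb hpred hin hprev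
  · have : splice β I v (a + 1) (b + 1) = splice β I v (a + 1) b := by
      funext q
      unfold splice
      split_ifs with hq
      · rcases hβ b with h | ⟨p, t, _, _, h, _⟩
        · rw [h]
        · rw [h, Function.update_of_ne]
          intro hqp
          have : w' u = p := by
            by_contra hne
            exact hu' (by rw [h, Function.update_of_ne hne])
          refine huI ?_
          rw [hwv, this, ← hqp, sub_add_cancel]
          exact hq
      · rfl
    rw [this]
    exact hβ.splice_succ_outer hne hwv hT ha hpred hprev

/-- Two windows cannot run through the same contents if the part of the assembly behind one window,
moved to the other window, leaves the region `I`: by `hX`, no tile can be the first one to do so. -/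
theorem IsGrowth.false_of_window_contents_eq {X : Set (ℤ × ℤ)} (hΓ : Γ.StrictlySelfAssembles X)
    (hβ : Γ.IsGrowth β) (hne : ∀ n, (β n).shape.Nonempty)
    (h0 : Γ.Producible (β 0)) (h0s : (β 0).Stable Γ.str Γ.temp)
    (hwv : ∀ u, w u = w' u + v) (hI : ∀ p ∈ I, p - v ∈ I') (hw : ∀ u, w' u ∈ I' → w u ∈ I)
    (hw0 : ∀ u, β 0 (w u) = none) (hw0' : ∀ u, β 0 (w' u) = none)
    (hI0 : ∀ p ∈ I, β 0 p = none) (hI0' : ∀ p ∈ I', β 0 p = none)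
    (hT : CrossesAtWindow (β T) I w) (hT' : CrossesAtWindow (β T') I' w')
    (hV : ∀ b ≤ T', ∃ a ≤ T, ∀ u, β a (w u) = β b (w' u))
    (hV' : ∀ a ≤ T, ∃ b ≤ T', ∀ u, β b (w' u) = β a (w u))
    (hout : ∃ p ∈ I', β T' p ≠ none ∧ p + v ∉ I)
    (hX : ∀ (p : ℤ × ℤ) (d : Side), p ∈ I' → p ∈ X → p + d.vec ∈ X →
      p + v ∉ I → p + d.vec + v ∈ I → p + d.vec + v ∈ X → False) : False := by
  -- Stage `b` is the last one before some tile behind `w'` has its translate outside `I`.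
  have hcross : ∃ b < T', (∀ p ∈ I', β b p ≠ none → p + v ∈ I) ∧
      ¬ ∀ p ∈ I', β (b + 1) p ≠ none → p + v ∈ I := by
    by_contra hc
    push Not at hc
    have : ∀ b ≤ T', ∀ p ∈ I', β b p ≠ none → p + v ∈ I := by
      intro b
      induction b with
      | zero => exact fun _ p hp hpn => absurd (hI0' p hp) hpn
      | succ b ih => exact fun hb => hc b (by omega) (ih (by omega))
    obtain ⟨p, hp, hpn, hpv⟩ := hout
    exact hpv (this T' le_rfl p hp hpn)
  obtain ⟨b, hb, hin, hnot⟩ := hcross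
  push Not at hnot
  obtain ⟨p, hp, hpn, hpv⟩ := hnot
  obtain ⟨a, ha, hab⟩ := hV b hb.le
  have hC := (hβ.splice_producible hne h0 h0s hwv hI
    hw0 hw0' hI0 hI0' hT hT' hV hV' _ a b rfl ha hb.le hab hin).1
  have hbp : β b p = none := by
    by_contra hc
    exact hpv (hin p hp hc)
  have hXβ : ∀ n q, β n q ≠ none → q ∈ X := fun n q hq =>
    hΓ.shape_subset (hβ.producible h0 n) hq
  rcases hβ b with h | ⟨q, t, _, hq, h, hs⟩
  · exact hpn (h ▸ hbp)
  have hpq : p = q := by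
    by_contra hc
    exact hpn (by rw [h, Function.update_of_ne hc, hbp])
  subst hpq
  obtain ⟨d, hd⟩ := exists_neighbour_of_stable_update (hne b) hq (h ▸ hs)
  -- A neighbour in `I'` has its translate tiled in the splice, hence in `X`, and `hX` applies. A
  -- neighbour outside `I'` makes `p` a window point, whose translate stays in `I`.
  by_cases hdI : p + d.vec ∈ I'
  · have hdv := hin _ hdI hd
    refine hX p d hp (hXβ _ _ hpn) (hXβ _ _ hd) hpv hdv (hΓ.shape_subset hC ?_)
    simpa [Assembly.shape, splice, hdv] using hd
  · obtain ⟨⟨u, hu⟩, -⟩ := hT' p d hp hdI (hβ.ne_none_of_le hb hpn)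
      (hβ.ne_none_of_le hb.le hd)
    refine hpv ?_
    rw [← hu, ← hwv]
    exact hw u (hu ▸ hp)

end Splice

end ATAMSystem

/-! ### Containment of binary digits: by Lucas' theorem, the odd entries of Pascal's triangle -/

/-- Every binary digit `1` of `k` is also a digit `1` of `n`. -/
def Submask (k n : ℕ) : Prop := ∀ b, k.testBit b = true → n.testBit b = true

namespace Submask

theorem refl (n : ℕ) : Submask n n := fun _ h => h

theorem le {k n : ℕ} (h : Submask k n) : k ≤ n := by
  have : k &&& n = k := by
    refine Nat.eq_of_testBit_eq fun b => ?_
    rw [Nat.testBit_and]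
    specialize h b
    cases hk : k.testBit b <;> simp_all
  rw [← this]
  exact Nat.and_le_right

theorem div_two {k n : ℕ} (h : Submask k n) : Submask (k / 2) (n / 2) := fun b hb => by
  rw [← Nat.testBit_succ] at hb ⊢
  exact h _ hb

theorem mod_two {k n : ℕ} (h : Submask k n) (hk : k % 2 = 1) : n % 2 = 1 := by
  simpa using h 0 (by simpa using hk)

theorem eq_zero_of_two_mul {k : ℕ} (h : Submask k (2 * k)) : k = 0 := by
  induction k using Nat.strong_induction_on with
  | _ k ih =>
    by_contra hk
    have h0 : k % 2 = 0 := by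
      by_contra h1
      have := h.mod_two (by omega)
      omega
    have h2 := h.div_two
    rw [show 2 * k / 2 = 2 * (k / 2) by omega] at h2
    have := ih (k / 2) (by omega) h2
    omega

theorem exists_two_pow_of_two_mul_add_one {k : ℕ} (h : Submask k (2 * k + 1)) :
    ∃ m, k + 1 = 2 ^ m := by
  induction k using Nat.strong_induction_on with
  | _ k ih =>
    rcases Nat.eq_zero_or_pos k with rfl | hk
    · exact ⟨0, rfl⟩
    have h2 := h.div_two
    rcases Nat.mod_two_eq_zero_or_one k with h0 | h1
    · rw [show (2 * k + 1) / 2 = 2 * (k / 2) by omega] at h2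
      have := eq_zero_of_two_mul h2
      omega
    · rw [show (2 * k + 1) / 2 = 2 * (k / 2) + 1 by omega] at h2
      obtain ⟨m, hm⟩ := ih (k / 2) (by omega) h2
      exact ⟨m + 1, by rw [pow_succ]; omega⟩

theorem testBit_two_pow_add {i x : ℕ} (hx : x < 2 ^ i) (b : ℕ) :
    (2 ^ i + x).testBit b = (decide (b = i) || x.testBit b) := by
  rcases lt_trichotomy b i with h | rfl | h
  · rw [Nat.testBit_two_pow_add_gt h]
    simp [h.ne]
  · rw [Nat.testBit_two_pow_add_eq, Nat.testBit_lt_two_pow hx]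
    simp
  · have h1 : 2 ^ (i + 1) ≤ 2 ^ b := Nat.pow_le_pow_right (by norm_num) h
    rw [pow_succ] at h1
    rw [Nat.testBit_lt_two_pow (by omega), Nat.testBit_lt_two_pow (by omega)]
    simp [h.ne']

theorem two_pow_add_right {i k n : ℕ} (hn : n < 2 ^ i) (h : Submask k n) :
    Submask k (2 ^ i + n) := fun b hb => by
  rw [testBit_two_pow_add hn, h b hb, Bool.or_true]

theorem two_pow_add {i k n : ℕ} (hn : n < 2 ^ i) (h : Submask k n) :
    Submask (2 ^ i + k) (2 ^ i + n) := fun b hb => by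
  rw [testBit_two_pow_add (h.le.trans_lt hn)] at hb
  rw [testBit_two_pow_add hn]
  specialize h b
  cases hk : k.testBit b <;> simp_all

theorem of_two_pow_add {i k n : ℕ} (hn : n < 2 ^ i) (h : Submask k (2 ^ i + n)) :
    Submask k n ∨ ∃ l, k = 2 ^ i + l ∧ Submask l n := by
  by_cases hk : k < 2 ^ i
  · left
    intro b hb
    have h1 := h b hb
    rw [testBit_two_pow_add hn] at h1
    have : b ≠ i := by
      rintro rfl
      rw [Nat.testBit_lt_two_pow hk] at hb
      exact absurd hb (by simp)
    simpa [this] using h1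
  · right
    have hl := h.le
    refine ⟨k - 2 ^ i, by omega, fun b hb => ?_⟩
    have hlt : k - 2 ^ i < 2 ^ i := by omega
    have hkk : 2 ^ i + (k - 2 ^ i) = k := by omega
    have h2 := testBit_two_pow_add hlt b
    rw [hkk, hb, Bool.or_true] at h2
    have h1 := h b h2
    rw [testBit_two_pow_add hn] at h1
    have : b ≠ i := by
      rintro rfl
      rw [Nat.testBit_lt_two_pow hlt] at hb
      exact absurd hb (by simp)
    simpa [this] using h1

theorem of_two_pow {i k : ℕ} (h : Submask k (2 ^ i)) : k = 0 ∨ k = 2 ^ i := by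
  rcases of_two_pow_add (n := 0) (by positivity) (by simpa using h) with h' | ⟨l, hl, h'⟩
  · exact Or.inl (Nat.le_zero.mp h'.le)
  · right
    have := Nat.le_zero.mp h'.le
    omega

/-- The row `2 ^ (m + 1) - 1`, moved up by `2 ^ i - 2 ^ j` rows, does not have entries both at
`2 ^ m - 1` and at `2 ^ m` if `j ≤ m` and `j < i`. -/
theorem not_both {i j m n k : ℕ} (hij : j < i) (hjm : j ≤ m) (hk : k + 1 = 2 ^ m)
    (hn : n + 2 ^ j = 2 * k + 1 + 2 ^ i) (h : Submask k n) (h' : Submask (k + 1) n) : False := by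
  -- Digit `j` is set in `k + 1 = 2 ^ m` if `j = m`, and in `k = 2 ^ m - 1` if `j < m`.
  have hbit : n.testBit j = true := by
    rcases hjm.eq_or_lt with rfl | hlt
    · refine h' _ ?_
      rw [hk, Nat.testBit_two_pow]
      simp
    · refine h _ ?_
      rw [show k = 2 ^ m - 1 by omega, Nat.testBit_two_pow_sub_one]
      simpa using hlt
  obtain ⟨a, rfl⟩ := Nat.exists_eq_add_of_lt hij
  obtain ⟨e, rfl⟩ := Nat.exists_eq_add_of_le hjm
  have h1 : 2 ^ (j + a + 1) = 2 ^ j * (2 * 2 ^ a) := by ring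
  have h2 : 2 ^ (j + e) = 2 ^ j * 2 ^ e := by ring
  have h3 : 0 < 2 ^ j := by positivity
  have h4 : 0 < 2 ^ e := by positivity
  have h5 : 0 < 2 ^ a := by positivity
  rw [h1] at hn
  rw [h2] at hk
  -- With `m = j + e` and `i = j + a + 1`, this shows that digit `j` of `n` is `0`.
  have hn' : n = (2 ^ j - 1) + 2 ^ j * (2 * (2 ^ e + 2 ^ a - 1)) := by
    obtain ⟨x, hx⟩ := Nat.exists_eq_succ_of_ne_zero h4.ne'
    rw [hx] at hk ⊢
    have e1 : x.succ + 2 ^ a - 1 = x + 2 ^ a := by omega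
    rw [e1]
    have e2 : 2 ^ j * (2 * (x + 2 ^ a)) = 2 * (2 ^ j * x) + 2 ^ j * (2 * 2 ^ a) := by ring
    have e3 : 2 ^ j * x.succ = 2 ^ j * x + 2 ^ j := by rw [Nat.succ_eq_add_one]; ring
    rw [e2]
    rw [e3] at hk
    omega
  rw [Nat.testBit_eq_decide_div_mod_eq, hn', Nat.add_mul_div_left _ _ h3,
    Nat.div_eq_of_lt (by omega)] at hbit
  simp at hbit

end Submask

/-! ### The triangle as Pascal's triangle mod 2, and its scaling -/

/-- Each odd entry `k` of row `n` contributes a `2 × 2` block. The two translates in the recursion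
set digit `i` of `n`, and set or leave clear digit `i` of `k`. -/
theorem mem_sierpinskiStage {i : ℕ} {p : ℤ × ℤ} :
    p ∈ sierpinskiStage i ↔ ∃ n k : ℕ, n < 2 ^ i ∧ Submask k n ∧
      (p.1 = 2 * k - n ∨ p.1 = 2 * k - n - 1) ∧ (p.2 = 2 * n ∨ p.2 = 2 * n + 1) := by
  induction i generalizing p with
  | zero =>
    obtain ⟨x, y⟩ := p
    simp only [sierpinskiStage, Set.mem_insert_iff, Set.mem_singleton_iff, Prod.mk.injEq, pow_zero,
      Nat.lt_one_iff]
    constructor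
    · intro h
      refine ⟨0, 0, rfl, Submask.refl 0, ?_, ?_⟩ <;> simp <;> omega
    · rintro ⟨n, k, rfl, h, h1, h2⟩
      have := h.le
      omega
  | succ i ih =>
    have hpow : (2 : ℕ) ^ (i + 1) = 2 ^ i + 2 ^ i := by ring
    simp only [sierpinskiStage, Set.mem_union, Set.mem_ofPred_eq, Set.mem_insert_iff,
      Set.mem_singleton_iff, ih]
    constructor
    · rintro (⟨n, k, hn, h⟩ | ⟨q, ⟨n, k, hn, hk, h1, h2⟩, v, rfl | rfl, rfl⟩)
      · exact ⟨n, k, by omega, h⟩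
      · refine ⟨2 ^ i + n, 2 ^ i + k, by omega, hk.two_pow_add hn, ?_, ?_⟩ <;>
        · simp only [Prod.fst_add, Prod.snd_add, Prod.smul_fst, Prod.smul_snd, smul_eq_mul]
          push_cast
          omega
      · refine ⟨2 ^ i + n, k, by omega, hk.two_pow_add_right hn, ?_, ?_⟩ <;>
        · simp only [Prod.fst_add, Prod.snd_add, Prod.smul_fst, Prod.smul_snd, smul_eq_mul]
          push_cast
          omega
    · rintro ⟨n, k, hn, hk, h1, h2⟩
      by_cases hni : n < 2 ^ i
      · exact Or.inl ⟨n, k, hni, hk, h1, h2⟩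
      right
      obtain ⟨n, rfl⟩ := Nat.exists_eq_add_of_le (not_lt.mp hni)
      push_cast at h1 h2
      rcases Submask.of_two_pow_add (by omega) hk with hl | ⟨l, rfl, hl⟩
      · refine ⟨(p.1 + 2 ^ i, p.2 - 2 * 2 ^ i), ⟨n, k, by omega, hl, by dsimp only; omega,
          by dsimp only; omega⟩, _, Or.inr rfl, ?_⟩
        ext <;> simp
        ring
      · push_cast at h1
        refine ⟨(p.1 - 2 ^ i, p.2 - 2 * 2 ^ i), ⟨n, l, by omega, hl, by dsimp only; omega,
          by dsimp only; omega⟩, _, Or.inl rfl, ?_⟩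
        ext <;> simp
        ring

theorem mem_sierpinskiTriangle {p : ℤ × ℤ} :
    p ∈ sierpinskiTriangle ↔ ∃ n k : ℕ, Submask k n ∧
      (p.1 = 2 * k - n ∨ p.1 = 2 * k - n - 1) ∧ (p.2 = 2 * n ∨ p.2 = 2 * n + 1) := by
  simp only [sierpinskiTriangle, Set.mem_iUnion, mem_sierpinskiStage]
  constructor
  · rintro ⟨_, n, k, _, h⟩
    exact ⟨n, k, h⟩
  · rintro ⟨n, k, h⟩
    exact ⟨n, n, k, Nat.lt_two_pow_self, h⟩

theorem sierpinskiTriangle_reflect {x y : ℤ} (h : (x, y) ∈ sierpinskiTriangle) :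
    (-1 - x, y) ∈ sierpinskiTriangle := by
  have key : ∀ i, ∀ p ∈ sierpinskiStage i, (-1 - p.1, p.2) ∈ sierpinskiStage i := by
    intro i
    induction i with
    | zero =>
      rintro ⟨x, y⟩ h
      simp only [sierpinskiStage, Set.mem_insert_iff, Set.mem_singleton_iff, Prod.mk.injEq] at h ⊢
      omega
    | succ i ih =>
      rintro p (h | ⟨q, hq, v, hv, rfl⟩)
      · exact Or.inl (ih p h)
      · refine Or.inr ⟨_, ih q hq, (-v.1, v.2), ?_, ?_⟩
        · rcases hv with rfl | rfl <;> simp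
        · ext <;> simp
          ring
  obtain ⟨i, hi⟩ := Set.mem_iUnion.mp h
  exact Set.mem_iUnion.mpr ⟨i, key i _ hi⟩

section Scale

variable {c : ℕ}

theorem cell_unique {x a b : ℤ} (ha : c * a ≤ x ∧ x < c * a + c) (hb : c * b ≤ x ∧ x < c * b + c) :
    a = b := by
  have hc : (0 : ℤ) ≤ c := by positivity
  have h1 : a < b + 1 := lt_of_mul_lt_mul_left (by linarith [mul_add (c : ℤ) b 1]) hc
  have h2 : b < a + 1 := lt_of_mul_lt_mul_left (by linarith [mul_add (c : ℤ) a 1]) hc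
  omega

theorem mem_of_mem_scaleShape {S : Set (ℤ × ℤ)} {x y a b : ℤ} (h : (x, y) ∈ scaleShape c S)
    (ha : c * a ≤ x ∧ x < c * a + c) (hb : c * b ≤ y ∧ y < c * b + c) : (a, b) ∈ S := by
  obtain ⟨q, hq, h1, h2⟩ := h
  rw [cell_unique ha h1, cell_unique hb h2]
  exact hq

theorem scaleShape_sierpinskiTriangle_reflect {x y : ℤ}
    (h : (x, y) ∈ scaleShape c sierpinskiTriangle) :
    (-1 - x, y) ∈ scaleShape c sierpinskiTriangle := by
  obtain ⟨q, hq, h1, h2⟩ := h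
  refine ⟨(-1 - q.1, q.2), sierpinskiTriangle_reflect hq, ?_, h2⟩
  dsimp only at h1 ⊢
  have : (c : ℤ) * (-1 - q.1) = -c - c * q.1 := by ring
  constructor <;> linarith

theorem centre_mem_scaleShape (hc : 0 < c) (j : ℕ) :
    (-1, (c : ℤ) * (2 * (2 * 2 ^ j - 1))) ∈ scaleShape c sierpinskiTriangle := by
  have hc' : (0 : ℤ) < c := by exact_mod_cast hc
  refine ⟨(-1, 2 * (2 * 2 ^ j - 1)), mem_sierpinskiTriangle.mpr
    ⟨2 ^ (j + 1) - 1, 2 ^ j - 1, ?_, ?_, ?_⟩, ?_, ?_⟩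
  · intro b hb
    simp only [Nat.testBit_two_pow_sub_one, decide_eq_true_eq] at hb ⊢
    omega
  · have := Nat.one_le_two_pow (n := j)
    have := Nat.one_le_two_pow (n := j + 1)
    push_cast [*]
    rw [pow_succ]
    left; ring
  · have := Nat.one_le_two_pow (n := j + 1)
    push_cast [*]
    rw [pow_succ]
    left; ring
  · constructor <;> dsimp only <;> linarith
  · constructor <;> dsimp only <;> linarith

theorem le_cell {y b m : ℤ} (hb : c * b ≤ y ∧ y < c * b + c) (h : c * m ≤ y) : m ≤ b := by
  have hc : (0 : ℤ) ≤ c := by positivity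
  have : m < b + 1 := lt_of_mul_lt_mul_left (by linarith [mul_add (c : ℤ) b 1]) hc
  omega

/-- Row `2 ^ j` has entries only at its two ends, and row `2 ^ j - 1` is narrower. In the left half
the blocks of these rows share just the column `-2 ^ j`. -/
theorem window_of_mem_scaleShape (hc : 0 < c) {j : ℕ} {x : ℤ} (hx : x < 0)
    (h : (x, (c : ℤ) * (2 * 2 ^ j)) ∈ scaleShape c sierpinskiTriangle)
    (h' : (x, (c : ℤ) * (2 * 2 ^ j) - 1) ∈ scaleShape c sierpinskiTriangle) :
    -(c * 2 ^ j : ℤ) ≤ x ∧ x < -(c * 2 ^ j : ℤ) + c := by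
  have hc' : (0 : ℤ) < c := by exact_mod_cast hc
  obtain ⟨⟨a, b⟩, hq, ha, -⟩ := id h
  dsimp only at ha
  have ha0 : a < 0 := by
    by_contra hcon
    have : 0 ≤ (c : ℤ) * a := mul_nonneg hc'.le (by omega)
    omega
  have m1 := mem_of_mem_scaleShape h ha (b := 2 * 2 ^ j) ⟨le_rfl, by omega⟩
  have m2 := mem_of_mem_scaleShape h' ha (b := 2 * 2 ^ j - 1)
    ⟨by rw [mul_sub]; omega, by rw [mul_sub]; omega⟩
  rw [mem_sierpinskiTriangle] at m1 m2
  obtain ⟨n, k, hk, h1, h2⟩ := m1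
  obtain ⟨n', k', hk', h1', h2'⟩ := m2
  dsimp only at h1 h2 h1' h2'
  have hn : n = 2 ^ j := by
    zify
    omega
  subst hn
  push_cast at h1
  have haj : a = -2 ^ j := by
    rcases hk.of_two_pow with rfl | rfl
    · push_cast at h1
      omega
    · push_cast at h1
      have : (1 : ℤ) ≤ 2 ^ j := one_le_pow₀ (by norm_num)
      omega
  rw [haj] at ha
  constructor <;> linarith

/-- Column `-1` belongs to entry `k` of row `2k` or `2k + 1`. The former is odd only in row `0`, the
latter only if `k + 1` is a power of two. -/
theorem exists_row_of_centre_mem (hc : 0 < c) {j : ℕ} {y : ℤ} (hy : (c : ℤ) * (2 * 2 ^ j) ≤ y)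
    (h : (-1, y) ∈ scaleShape c sierpinskiTriangle) :
    ∃ (m k : ℕ) (b : ℤ), j ≤ m ∧ k + 1 = 2 ^ m ∧ (c * b ≤ y ∧ y < c * b + c) ∧
      (b = 2 * (2 * k + 1) ∨ b = 2 * (2 * k + 1) + 1) := by
  have hc' : (0 : ℤ) < c := by exact_mod_cast hc
  obtain ⟨⟨a, b⟩, hq, -, hb⟩ := id h
  dsimp only at hb
  have hm := mem_of_mem_scaleShape h (a := -1) (by constructor <;> omega) hb
  obtain ⟨n, k, hk, h1, h2⟩ := mem_sierpinskiTriangle.mp hm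
  dsimp only at h1 h2
  have hbj := le_cell hb hy
  have h2j : (1 : ℤ) ≤ 2 ^ j := one_le_pow₀ (by norm_num)
  have hn : n = 2 * k + 1 := by
    rcases h1 with h1 | h1
    · omega
    · have : n = 2 * k := by omega
      subst this
      have := hk.eq_zero_of_two_mul
      omega
  subst hn
  obtain ⟨m, hkm⟩ := hk.exists_two_pow_of_two_mul_add_one
  refine ⟨m, k, b, ?_, hkm, hb, by push_cast at h2; exact h2⟩
  have h3 : (2 : ℤ) ^ j < 2 ^ (m + 1) := by
    have : (k : ℤ) + 1 = 2 ^ m := by exact_mod_cast hkm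
    rw [pow_succ]
    push_cast at h2
    omega
  have := (pow_lt_pow_iff_right₀ (by norm_num : (1 : ℤ) < 2)).mp h3
  omega

theorem translated_centre_not_mem (hc : 0 < c) {i j : ℕ} (hij : j < i) {y : ℤ}
    (hy : (c : ℤ) * (2 * 2 ^ j) ≤ y) (h : (-1, y) ∈ scaleShape c sierpinskiTriangle)
    (h1 : (-1 - c * (2 ^ i - 2 ^ j : ℤ), y + c * (2 * (2 ^ i - 2 ^ j) : ℤ)) ∈
      scaleShape c sierpinskiTriangle)
    (h2 : (0 - c * (2 ^ i - 2 ^ j : ℤ), y + c * (2 * (2 ^ i - 2 ^ j) : ℤ)) ∈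
      scaleShape c sierpinskiTriangle) : False := by
  have hc' : (0 : ℤ) < c := by exact_mod_cast hc
  obtain ⟨m, k, b, hjm, hkm, hb, hbk⟩ := exists_row_of_centre_mem hc hy h
  set D : ℤ := 2 ^ i - 2 ^ j with hD
  have hb' : c * (b + 2 * D) ≤ y + c * (2 * D) ∧ y + c * (2 * D) < c * (b + 2 * D) + c := by
    rw [mul_add]
    omega
  have m1 := mem_of_mem_scaleShape h1 (a := -1 - D)
    (by rw [mul_sub]; constructor <;> omega) hb'
  have m2 := mem_of_mem_scaleShape h2 (a := -D)
    (by rw [mul_neg]; constructor <;> omega) hb'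
  obtain ⟨n, l, hl, e1, e2⟩ := mem_sierpinskiTriangle.mp m1
  obtain ⟨n', l', hl', e1', e2'⟩ := mem_sierpinskiTriangle.mp m2
  dsimp only at e1 e2 e1' e2'
  have hn : (n : ℤ) = 2 * k + 1 + D := by omega
  have hn' : n' = n := by omega
  subst hn'
  have hl1 : l = k := by omega
  have hl2 : l' = k + 1 := by omega
  subst hl1 hl2
  refine Submask.not_both (n := n') hij hjm hkm ?_ hl hl'
  zify
  omega

end Scale

/-! ### Corner windows and the regions above the stages -/

/-- The reflection of the plane that swaps the two halves of the triangle if `s` is true, and the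
identity otherwise. -/
def reflect (s : Bool) (p : ℤ × ℤ) : ℤ × ℤ := if s then (-1 - p.1, p.2) else p

theorem reflect_reflect (s : Bool) (p : ℤ × ℤ) : reflect s (reflect s p) = p := by
  cases s <;> simp [reflect]

theorem reflect_snd (s : Bool) (p : ℤ × ℤ) : (reflect s p).2 = p.2 := by
  cases s <;> rfl

theorem reflect_add_vec (s : Bool) (p : ℤ × ℤ) (d : Side) :
    ∃ e : Side, reflect s (p + d.vec) = reflect s p + e.vec := by
  cases s
  · exact ⟨d, rfl⟩
  · cases d
    · exact ⟨.north, by ext <;> simp [reflect, Side.vec]⟩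
    · exact ⟨.west, by ext <;> simp [reflect, Side.vec]; ring⟩
    · exact ⟨.south, by ext <;> simp [reflect, Side.vec]⟩
    · exact ⟨.east, by ext <;> simp [reflect, Side.vec]; ring⟩

theorem reflect_mem_scaleShape {c : ℕ} (s : Bool) {p : ℤ × ℤ}
    (h : p ∈ scaleShape c sierpinskiTriangle) :
    reflect s p ∈ scaleShape c sierpinskiTriangle := by
  cases s
  · exact h
  · exact scaleShape_sierpinskiTriangle_reflect h

/-- The part of one half of the plane that lies above the stage `S_j`, scaled by `c`. -/
def upperRegion (c j : ℕ) (s : Bool) : Set (ℤ × ℤ) :=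
  {p | (reflect s p).1 < 0 ∧ (c : ℤ) * (2 * 2 ^ j) ≤ p.2}

/-- The points on both sides of the only edges of the scaled triangle that lead from the stage
`S_j` up to `upperRegion c j s`. -/
def cornerWindow (c j : ℕ) (s : Bool) (u : Fin c × Bool) : ℤ × ℤ :=
  reflect s (-(c * 2 ^ j : ℤ) + (u.1 : ℕ), c * (2 * 2 ^ j) - if u.2 then 0 else 1)

/-- The translation from the corner of the stage `S_i` to the corner of the stage `S_j`. -/
def cornerShift (c i j : ℕ) (s : Bool) : ℤ × ℤ :=
  (if s then -(c * (2 ^ i - 2 ^ j)) else c * (2 ^ i - 2 ^ j), -(c * (2 * (2 ^ i - 2 ^ j))))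

theorem reflect_add_cornerShift (c i j : ℕ) (s : Bool) (p : ℤ × ℤ) :
    reflect s (p + cornerShift c i j s) =
      reflect s p + (c * (2 ^ i - 2 ^ j : ℤ), -(c * (2 * (2 ^ i - 2 ^ j)) : ℤ)) := by
  cases s <;> ext <;> simp [reflect, cornerShift]
  ring

theorem cornerWindow_eq_add (c i j : ℕ) (s : Bool) (u : Fin c × Bool) :
    cornerWindow c j s u = cornerWindow c i s u + cornerShift c i j s := by
  rw [← reflect_reflect s (cornerWindow c i s u + _), reflect_add_cornerShift, cornerWindow,
    cornerWindow, reflect_reflect]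
  congr 1
  ext <;> simp <;> ring

theorem cornerWindow_mem_upperRegion {c j : ℕ} {s : Bool} {u : Fin c × Bool} :
    cornerWindow c j s u ∈ upperRegion c j s ↔ u.2 = true := by
  have h1 : ((u.1 : ℕ) : ℤ) < c := by exact_mod_cast u.1.isLt
  have h2 : (c : ℤ) ≤ c * 2 ^ j :=
    le_mul_of_one_le_right (by positivity) (one_le_pow₀ (by norm_num))
  simp only [upperRegion, cornerWindow, Set.mem_ofPred_eq, reflect_reflect, reflect_snd]
  cases u.2 <;> simp
  linarith

theorem add_cornerShift_mem_upperRegion {c i j : ℕ} {s : Bool} {p : ℤ × ℤ} :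
    p + cornerShift c i j s ∈ upperRegion c j s ↔
      (reflect s p).1 + c * (2 ^ i - 2 ^ j) < 0 ∧ (c : ℤ) * (2 * 2 ^ i) ≤ p.2 := by
  have h2 : (p + cornerShift c i j s).2 = p.2 - c * (2 * (2 ^ i - 2 ^ j)) := rfl
  simp only [upperRegion, Set.mem_ofPred_eq, reflect_add_cornerShift, Prod.fst_add, h2]
  have : (c : ℤ) * (2 * (2 ^ i - 2 ^ j)) = c * (2 * 2 ^ i) - c * (2 * 2 ^ j) := by ring
  rw [this]
  refine and_congr Iff.rfl ?_
  constructor <;> intro h <;> linarith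

theorem sub_cornerShift_mem_upperRegion {c i j : ℕ} (hij : j < i) {s : Bool} {p : ℤ × ℤ}
    (hp : p ∈ upperRegion c j s) : p - cornerShift c i j s ∈ upperRegion c i s := by
  rw [← sub_add_cancel p (cornerShift c i j s), add_cornerShift_mem_upperRegion] at hp
  refine ⟨?_, hp.2⟩
  have h1 : (2 : ℤ) ^ j ≤ 2 ^ i := pow_le_pow_right₀ (by norm_num) hij.le
  have h2 : 0 ≤ (c : ℤ) * (2 ^ i - 2 ^ j) := mul_nonneg (by positivity) (by linarith)
  linarith [hp.1]

theorem false_of_crossing {c i j : ℕ} (hc : 0 < c) (hij : j < i) {s : Bool} (p : ℤ × ℤ)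
    (d : Side) (hp : p ∈ upperRegion c i s) (hpX : p ∈ scaleShape c sierpinskiTriangle)
    (hqX : p + d.vec ∈ scaleShape c sierpinskiTriangle)
    (hpv : p + cornerShift c i j s ∉ upperRegion c j s)
    (hqv : p + d.vec + cornerShift c i j s ∈ upperRegion c j s)
    (hqvX : p + d.vec + cornerShift c i j s ∈ scaleShape c sierpinskiTriangle) : False := by
  obtain ⟨e, he⟩ := reflect_add_vec s p d
  have hs := reflect_snd s p
  rw [add_cornerShift_mem_upperRegion] at hpv hqv
  have hpX' := reflect_mem_scaleShape s hpX
  have hqX' := reflect_mem_scaleShape s hqX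
  have hqvX' := reflect_mem_scaleShape s hqvX
  rw [reflect_add_cornerShift] at hqvX'
  rw [he] at hqX' hqvX' hqv
  have hp2 := hp.2
  have hp1 : ¬ (reflect s p).1 + c * (2 ^ i - 2 ^ j) < 0 := fun h => hpv ⟨h, hp2⟩
  have hq1 := hqv.1
  rw [← hs] at hp2
  generalize reflect s p = P at *
  obtain ⟨x, y⟩ := P
  have hy : (c : ℤ) * (2 * 2 ^ j) ≤ y - c * (2 * (2 ^ i - 2 ^ j)) := by
    have : (c : ℤ) * (2 * (2 ^ i - 2 ^ j)) = c * (2 * 2 ^ i) - c * (2 * 2 ^ j) := by ring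
    dsimp only at hp2
    linarith
  cases e <;> simp only [Side.vec, Prod.mk_add_mk] at hq1 hp1 hqX' hqvX' <;> try omega
  -- Only a westward neighbour remains: after the shift, the new tile is in column `0` and its
  -- neighbour in column `-1`.
  have hx : x = 0 - c * (2 ^ i - 2 ^ j) := by omega
  refine translated_centre_not_mem hc hij hy ?_ ?_ ?_
  · convert! hqvX' using 2 <;> first | (rw [hx]; ring) | ring
  · convert! hqX' using 2 <;> first | (rw [hx]; ring) | ring
  · convert! hpX' using 2 <;> first | rw [hx] | ring

/-- An assembly within the scaled triangle that leaves the opposite side of the centre line empty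
has bonds out of the region above the stage `S_j` only at the corner. -/
theorem crossesAtWindow_cornerWindow {G : Type*} {c j : ℕ} (hc : 0 < c) {s : Bool}
    {A : Assembly G} (hA : A.shape ⊆ scaleShape c sierpinskiTriangle)
    (h0 : ∀ y : ℤ, (c : ℤ) * (2 * 2 ^ j) ≤ y → (-1, y) ∈ scaleShape c sierpinskiTriangle →
      A (reflect s (0, y)) = none) :
    ATAMSystem.CrossesAtWindow A (upperRegion c j s) (cornerWindow c j s) := by
  intro p d hp hpd hAp hApd
  have hpX := reflect_mem_scaleShape s (hA hAp)
  have hqX := reflect_mem_scaleShape s (hA hApd)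
  obtain ⟨e, he⟩ := reflect_add_vec s p d
  have e1 := reflect_reflect s p
  have e2 := reflect_reflect s (p + d.vec)
  have hs1 := reflect_snd s p
  have hs2 := reflect_snd s (p + d.vec)
  rw [he] at hqX e2 hs2
  simp only [upperRegion, Set.mem_ofPred_eq, he] at hp hpd
  clear he
  generalize p + d.vec = q at *
  rw [← hs1] at hp
  rw [← hs2] at hpd
  generalize reflect s p = P at *
  obtain ⟨x, y⟩ := P
  obtain ⟨hx, hy⟩ := hp
  cases e <;> simp only [Side.vec, Prod.mk_add_mk, add_zero] at hpd hqX e2 hx hy <;>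
    try (exfalso; exact hpd ⟨by omega, by omega⟩)
  · have hx1 : x = -1 := by
      by_contra hcon
      exact hpd ⟨by omega, hy⟩
    subst hx1
    exact absurd (by rw [← e2]; exact h0 y hy hpX) hApd
  · have hy1 : y = c * (2 * 2 ^ j) := by
      by_contra hcon
      exact hpd ⟨hx, by omega⟩
    subst hy1
    obtain ⟨w1, w2⟩ := window_of_mem_scaleShape hc hx hpX hqX
    have hlt : (x + c * 2 ^ j).toNat < c := by omega
    refine ⟨⟨(⟨_, hlt⟩, true), ?_⟩, ⟨(⟨_, hlt⟩, false), ?_⟩⟩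
    · rw [← e1, cornerWindow]
      congr 1
      ext
      · dsimp only; omega
      · simp
    · rw [← e2, cornerWindow]
      congr 1
      ext
      · dsimp only; omega
      · simp; ring

/-- At the first time that a growth sequence touches the centre line above the stage `S_j`, one of
the two sides of the centre line is still empty there. -/
theorem ATAMSystem.IsGrowth.exists_first_touch {G : Type*} {Γ : ATAMSystem G}
    {β : ℕ → Assembly G} (hβ : Γ.IsGrowth β) {c : ℕ} (hc : 0 < c)
    (hcover : ∀ p ∈ scaleShape c sierpinskiTriangle, ∃ n, β n p ≠ none) {j : ℕ}
    (h0 : ∀ p : ℤ × ℤ, (c : ℤ) * (2 * 2 ^ j) ≤ p.2 → β 0 p = none) :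
    ∃ (s : Bool) (T : ℕ),
      (∀ y : ℤ, (c : ℤ) * (2 * 2 ^ j) ≤ y → (-1, y) ∈ scaleShape c sierpinskiTriangle →
        β T (reflect s (0, y)) = none) ∧
      ∃ y : ℤ, (c : ℤ) * (2 * 2 ^ j) ≤ y ∧ β T (reflect s (-1, y)) ≠ none := by
  classical
  have hex : ∃ n, ∃ y : ℤ, (c : ℤ) * (2 * 2 ^ j) ≤ y ∧
      (-1, y) ∈ scaleShape c sierpinskiTriangle ∧
      (β n (-1, y) ≠ none ∨ β n (0, y) ≠ none) := by
    have hmem := centre_mem_scaleShape hc j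
    obtain ⟨n, hn⟩ := hcover _ hmem
    refine ⟨n, _, ?_, hmem, Or.inl hn⟩
    have : (1 : ℤ) ≤ 2 ^ j := one_le_pow₀ (by norm_num)
    exact mul_le_mul_of_nonneg_left (by linarith) (by positivity)
  obtain ⟨T, hT, hmin⟩ : ∃ T, (∃ y : ℤ, (c : ℤ) * (2 * 2 ^ j) ≤ y ∧
      (-1, y) ∈ scaleShape c sierpinskiTriangle ∧
      (β T (-1, y) ≠ none ∨ β T (0, y) ≠ none)) ∧ ∀ n < T, ∀ y : ℤ, (c : ℤ) * (2 * 2 ^ j) ≤ y →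
      (-1, y) ∈ scaleShape c sierpinskiTriangle → β n (-1, y) = none ∧ β n (0, y) = none := by
    refine ⟨Nat.find hex, Nat.find_spec hex, fun n hn y hy hyX => ?_⟩
    have := Nat.find_min hex hn
    push Not at this
    exact this y hy hyX
  obtain ⟨y, hy, hyX, hyT⟩ := hT
  obtain _ | T := T
  · rcases hyT with h | h
    · exact absurd (h0 _ hy) h
    · exact absurd (h0 _ hy) h
  have hprev := hmin T (Nat.lt_succ_self T)
  rcases hβ T with h | ⟨p, t, -, -, h, -⟩
  · rw [h] at hyT
    have := hprev y hy hyX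
    simp [this] at hyT
  -- Only one tile is new, so the two sides of the centre line cannot be touched at once.
  have hp : ∀ q : ℤ × ℤ, β T q = none → β (T + 1) q ≠ none → q = p := fun q hq hq' => by
    by_contra hne
    exact hq' (by rw [h, Function.update_of_ne hne, hq])
  rcases hyT with hyT | hyT
  · refine ⟨false, T + 1, fun z hz hzX => ?_, y, hy, hyT⟩
    by_contra hcon
    have h1 := hp _ (hprev y hy hyX).1 hyT
    have h2 := hp (0, z) (hprev z hz hzX).2 hcon
    simpa using (Prod.ext_iff.mp (h1.trans h2.symm)).1
  · refine ⟨true, T + 1, fun z hz hzX => ?_, y, hy, by simpa [reflect] using hyT⟩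
    by_contra hcon
    have h1 := hp _ (hprev y hy hyX).2 hyT
    have h2 := hp (-1, z) (hprev z hz hzX).1 (by simpa [reflect] using hcon)
    simpa using (Prod.ext_iff.mp (h1.trans h2.symm)).1

/-! ### The pigeonhole argument -/

theorem not_finite_scaleShape_sierpinskiTriangle {c : ℕ} (hc : 0 < c) :
    ¬ (scaleShape c sierpinskiTriangle).Finite := by
  have hc' : (c : ℤ) ≠ 0 := by exact_mod_cast hc.ne'
  refine (Set.infinite_range_of_injective
    (f := fun j : ℕ => ((-1, (c : ℤ) * (2 * (2 * 2 ^ j - 1))) : ℤ × ℤ)) ?_).mono ?_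
  · intro a b h
    have h1 := mul_left_cancel₀ hc' (Prod.mk.inj h).2
    exact Nat.pow_right_injective (le_refl 2) (by zify; omega)
  · rintro _ ⟨j, rfl⟩
    exact centre_mem_scaleShape hc j

theorem theorem4 {G : Type*} (c : ℕ) (hc : 0 < c) (Γ : ATAMSystem G) :
    ¬ Γ.StrictlySelfAssembles (scaleShape c sierpinskiTriangle) := by
  intro hΓ
  obtain ⟨α, hα0, hα, hαX⟩ := hΓ Γ.seed .base
  have hα : Γ.IsGrowth α := hα
  have hαp : ∀ n, Γ.Producible (α n) := hα.producible (hα0 ▸ .base)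
  -- The seed need not be stable, so the argument starts at an assembly obtained by an attachment.
  obtain ⟨n₀, hn₀⟩ : ∃ n, α n ≠ Γ.seed := by
    by_contra hcon
    push Not at hcon
    refine not_finite_scaleShape_sierpinskiTriangle hc ?_
    rw [← hαX]
    simp only [hcon, Set.iUnion_const]
    exact Γ.seed_finite
  set β : ℕ → Assembly G := fun n => α (n₀ + n) with hβdef
  have hβ : Γ.IsGrowth β := fun n => hα (n₀ + n)
  have h0 : Γ.Producible (β 0) := hαp n₀
  have h0s : (β 0).Stable Γ.str Γ.temp := (hαp n₀).stable hn₀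
  have hne : ∀ n, (β n).shape.Nonempty := fun n => by
    obtain ⟨p, hp⟩ := Γ.seed_nonempty
    exact ⟨p, hα.ne_none_of_le (Nat.zero_le _) (by rw [hα0]; exact hp)⟩
  have hcover : ∀ p ∈ scaleShape c sierpinskiTriangle, ∃ n, β n p ≠ none := by
    intro p hp
    rw [← hαX] at hp
    obtain ⟨n, hn⟩ := Set.mem_iUnion.mp hp
    exact ⟨n, hα.ne_none_of_le (Nat.le_add_left n n₀) hn⟩
  have hX : ∀ n, (β n).shape ⊆ scaleShape c sierpinskiTriangle := fun n =>
    hΓ.shape_subset (hβ.producible h0 n)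
  obtain ⟨Y, hY⟩ : ∃ Y : ℕ, ∀ p : ℤ × ℤ, (Y : ℤ) ≤ p.2 → β 0 p = none := by
    obtain ⟨B, hB⟩ := (h0.finite_shape.image Prod.snd).bddAbove
    refine ⟨(B + 1).toNat, fun p hp => ?_⟩
    by_contra hcon
    have := hB ⟨p, hcon, rfl⟩
    omega
  -- The `- 1` covers the lower row of the window.
  have hlow : ∀ i (p : ℤ × ℤ), (c : ℤ) * (2 * 2 ^ (Y + i)) - 1 ≤ p.2 → β 0 p = none := by
    refine fun i p hp => hY p (le_trans ?_ hp)
    have h1 : Y + i < 2 ^ (Y + i) := Nat.lt_two_pow_self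
    have h2 : 2 * 2 ^ (Y + i) ≤ c * (2 * 2 ^ (Y + i)) := Nat.le_mul_of_pos_left _ hc
    zify at h1 h2
    omega
  have htouch := fun i => hβ.exists_first_touch hc hcover (j := Y + i)
    (fun p hp => hlow i p (by linarith))
  choose s T hT hleft using htouch
  have htiles : {o : Option (Tile G) | ∀ t, o = some t → t ∈ Γ.tiles}.Finite := by
    refine ((Γ.tiles_finite.image some).insert none).subset fun o ho => ?_
    cases o with
    | none => exact Or.inl rfl
    | some t => exact Or.inr ⟨t, ho t rfl, rfl⟩
  have hfin := Set.finite_univ (α := Bool) |>.prod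
    (Set.Finite.pi' (fun _ : Fin c × Bool => htiles)).powerset
  -- The pigeonholes record the touching side and the set of window contents, without times.
  obtain ⟨i, -, i', -, hii, heq⟩ := Set.infinite_univ.exists_ne_map_eq_of_mapsTo
    (f := fun i => (s i, {g : Fin c × Bool → Option (Tile G) |
      ∃ a ≤ T i, g = fun u => β a (cornerWindow c (Y + i) (s i) u)})) (by
      rintro i -
      refine ⟨trivial, ?_⟩
      rintro _ ⟨a, -, rfl⟩ u t ht
      exact (hβ.producible h0 a).mem_tiles _ t ht) hfin
  wlog hlt : i < i' generalizing i i'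
  · exact this i' i hii.symm heq.symm (by omega)
  obtain ⟨hs, hV⟩ := Prod.mk.inj heq
  have hreg : ∀ i, ∀ p ∈ upperRegion c (Y + i) (s i), β 0 p = none := fun i p hp =>
    hlow i p (by linarith [hp.2])
  have hwin : ∀ i u, β 0 (cornerWindow c (Y + i) (s i) u) = none := fun i u => by
    refine hlow i _ ?_
    rw [cornerWindow, reflect_snd]
    dsimp only
    split_ifs <;> linarith
  have hcr : ∀ i, ATAMSystem.CrossesAtWindow (β (T i)) (upperRegion c (Y + i) (s i))
      (cornerWindow c (Y + i) (s i)) := fun i => crossesAtWindow_cornerWindow hc (hX _) (hT i)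
  have hreg' := hreg i'
  have hwin' := hwin i'
  have hcr' := hcr i'
  have hleft' := hleft i'
  rw [← hs] at hreg' hwin' hcr' hleft' hV
  refine hβ.false_of_window_contents_eq hΓ hne h0 h0s (T := T i) (T' := T i')
    (cornerWindow_eq_add c (Y + i') (Y + i) (s i))
    (fun p hp => sub_cornerShift_mem_upperRegion (by omega) hp)
    (fun u hu => cornerWindow_mem_upperRegion.mpr (cornerWindow_mem_upperRegion.mp hu))
    (hwin i) hwin' (hreg i) hreg' (hcr i) hcr' ?_ ?_ ?_
    (fun p d => false_of_crossing hc (by omega) p d)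
  · intro b hb
    obtain ⟨a, ha, hab⟩ := hV.ge ⟨b, hb, rfl⟩
    exact ⟨a, ha, fun u => (congrFun hab u).symm⟩
  · intro a ha
    obtain ⟨b, hb, hab⟩ := hV.le ⟨a, ha, rfl⟩
    exact ⟨b, hb, fun u => (congrFun hab u).symm⟩
  · obtain ⟨y, hy, hyT⟩ := hleft'
    refine ⟨_, ⟨?_, ?_⟩, hyT, ?_⟩
    · rw [reflect_reflect]
      norm_num
    · rwa [reflect_snd]
    · rw [add_cornerShift_mem_upperRegion, reflect_reflect]
      rintro ⟨h, -⟩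
      have h1 : (2 : ℤ) ^ (Y + i) < 2 ^ (Y + i') := pow_lt_pow_right₀ (by norm_num) (by omega)
      have h2 : 0 < (c : ℤ) * (2 ^ (Y + i') - 2 ^ (Y + i)) :=
        mul_pos (by exact_mod_cast hc) (by linarith)
      dsimp only at h
      omega
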